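/- Let $G$ be a finite simple planar graph with minimum degree $\delta(G)\ge 2$ and girth $g(G)\ge 10$, where $g(G)$ is the length of a shortest cycle of $G$ (and $g(G)=\infty$ if $G$ has no cycle). Then $G$ contains at least one of the following: (a) a $(2,2)$-edge, that is, an edge $uv$ with $d(u)=d(v)=2$; (b) a vertex $v$ with $d(v)\ge 3$ all of whose neighbors have degree exactly $2$. -/

import Mathlib

/-- The Euclidean plane. -/
abbrev Plane : Type := EuclideanSpace ℝ (Fin 2)

/-- `A` is a simple polygonal arc in the plane with endpoints `a` and `b`: the union of the
segments `[x 0, x 1], …, [x (n-1), x n]` (`n ≥ 1`), where `x 0 = a` and `x n = b`, no segment is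
degenerate, consecutive segments meet only in their common endpoint, and non-consecutive segments
are disjoint. -/
def IsPolygonalArc (a b : Plane) (A : Set Plane) : Prop :=
  ∃ (n : ℕ) (x : ℕ → Plane), 0 < n ∧ x 0 = a ∧ x n = b ∧
    (∀ i < n, x i ≠ x (i + 1)) ∧
    (∀ i, i + 1 < n →
      segment ℝ (x i) (x (i + 1)) ∩ segment ℝ (x (i + 1)) (x (i + 2)) = {x (i + 1)}) ∧
    (∀ i j, i + 1 < j → j < n →
      Disjoint (segment ℝ (x i) (x (i + 1))) (segment ℝ (x j) (x (j + 1)))) ∧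
    A = ⋃ i ∈ Set.Iio n, segment ℝ (x i) (x (i + 1))

/-- A plane drawing of `G` without crossings: distinct vertices are distinct points, every edge
is a simple polygonal arc joining its two endvertices and passing through no other vertex, and two
distinct edges meet only in endvertices that they share. -/
structure PlaneDrawing {V : Type*} (G : SimpleGraph V) where
  /-- the point representing a vertex -/
  pos : V → Plane
  /-- the arc representing an edge (the value at a pair that is not an edge is irrelevant) -/
  arc : Sym2 V → Set Plane
  pos_injective : Function.Injective pos
  isPolygonalArc : ∀ u v, G.Adj u v → IsPolygonalArc (pos u) (pos v) (arc s(u, v))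
  mem_of_pos_mem : ∀ e ∈ G.edgeSet, ∀ w, pos w ∈ arc e → w ∈ e
  inter_subset : ∀ e ∈ G.edgeSet, ∀ f ∈ G.edgeSet, e ≠ f →
    arc e ∩ arc f ⊆ pos '' {w | w ∈ e ∧ w ∈ f}

/-- A graph is planar if it can be drawn in the plane without crossings. -/
def IsPlanar {V : Type*} (G : SimpleGraph V) : Prop :=
  Nonempty (PlaneDrawing G)

/-! Suppose that neither (a) nor (b) occurs. Give each vertex the charge `4 d(v)` and let every
vertex of degree at least 3 send 1 to each neighbour of degree 2. All final charges are at least 10,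
so `5|V| ≤ 4|E|` (`five_mul_card_le_four_mul_card_edges`). Planarity and girth at least 10 give
`4|E| + 5 ≤ 5|V|` (`PolylineDrawing.card_edges_le`), a contradiction.

The second bound needs only one half of Euler's formula, `|E| + 1 ≤ |V| + |Q|`, where `Q` is a set
of combinatorial faces: classes of directed edges under "turn into the next edge around the head".
It is proved without the Jordan curve theorem. For a circulation `Z` on the edges, the sum of `Z ·
log((t - z)/(s - z))` over all segments `[s, t]` of the drawing has derivative zero off the drawing
and jumps by `2πi Z e` across the edge `e` (`IsSegmentSystem.exists_hasLeftLimit`). Its left limit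
is the same along an edge and along the next edge of the face (`IsSegmentSystem.exists_next`), so
`2πi Z` is the coboundary of a function on `Q`. Circulations have dimension at least `|E| - |V|`,
coboundaries at most `|Q| - 1` (`card_add_one_le_of_ker_le_coboundary`).

Following a face never backtracks, so each class contains at least `g` directed edges when the girth
is at least `g` (`SimpleGraph.ne_of_lt_egirth`). Hence `g|Q| ≤ 2|E|`. -/

/-! ### Half-planes and segments in the complex plane -/

/-- The open half-plane to the left of the line through `a` and `c`, directed from `a` to `c`. -/
def leftHalfPlane (a c : ℂ) : Set ℂ := {z | 0 < ((z - a) / (c - a)).im}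

lemma leftHalfPlane_swap {a c : ℂ} (h : a ≠ c) :
    leftHalfPlane c a = {z | ((z - a) / (c - a)).im < 0} := by
  ext z
  have h1 : c - a ≠ 0 := sub_ne_zero.2 h.symm
  have h2 : a - c ≠ 0 := sub_ne_zero.2 h
  have : (z - c) / (a - c) = 1 - (z - a) / (c - a) := by
    field_simp
    ring
  simp [leftHalfPlane, this]

lemma convex_leftHalfPlane (a c : ℂ) : Convex ℝ (leftHalfPlane a c) := by
  intro x hx y hy u v hu hv huv
  simp only [leftHalfPlane, Set.mem_ofPred_eq] at *
  have huv' : (u : ℂ) + v = 1 := by exact_mod_cast huv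
  have : (u • x + v • y - a) / (c - a) = u * ((x - a) / (c - a)) + v * ((y - a) / (c - a)) := by
    simp only [Complex.real_smul, div_eq_mul_inv]
    linear_combination (a * (c - a)⁻¹) * huv'
  rw [this]
  simp only [Complex.add_im, Complex.im_ofReal_mul]
  rcases hu.eq_or_lt with rfl | hu
  · simp only [zero_add] at huv
    simpa [huv] using hy
  · have := mul_pos hu hx
    have := mul_nonneg hv hy.le
    linarith

lemma exists_of_mem_openSegment {a c m : ℂ} (hm : m ∈ openSegment ℝ a c) :
    ∃ r : ℝ, 0 < r ∧ r < 1 ∧ m = a + r * (c - a) := by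
  rw [openSegment_eq_image'] at hm
  obtain ⟨r, hr, rfl⟩ := hm
  exact ⟨r, hr.1, hr.2, by simp⟩

lemma add_mul_mem_openSegment (a c : ℂ) {r : ℝ} (h0 : 0 < r) (h1 : r < 1) :
    a + r * (c - a) ∈ openSegment ℝ a c := by
  rw [openSegment_eq_image']
  exact ⟨r, ⟨h0, h1⟩, by simp⟩

lemma exists_of_mem_segment {a c m : ℂ} (hm : m ∈ segment ℝ a c) :
    ∃ r : ℝ, 0 ≤ r ∧ r ≤ 1 ∧ m = a + r * (c - a) := by
  rw [segment_eq_image'] at hm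
  obtain ⟨r, hr, rfl⟩ := hm
  exact ⟨r, hr.1, hr.2, by simp⟩

lemma notMem_leftHalfPlane_of_mem_segment {a c m : ℂ} (h : a ≠ c) (hm : m ∈ segment ℝ a c) :
    m ∉ leftHalfPlane a c := by
  obtain ⟨r, -, -, rfl⟩ := exists_of_mem_segment hm
  have h1 : c - a ≠ 0 := sub_ne_zero.2 h.symm
  simp [leftHalfPlane, h1]

lemma isClosed_segment (a c : ℂ) : IsClosed (segment ℝ a c) := by
  rw [segment_eq_image']
  exact (isCompact_Icc.image (by fun_prop)).isClosed

lemma nhdsWithin_leftHalfPlane_neBot {a c m : ℂ} (h : a ≠ c) (hm : m ∈ openSegment ℝ a c) :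
    (nhdsWithin m (leftHalfPlane a c)).NeBot := by
  obtain ⟨r, -, -, rfl⟩ := exists_of_mem_openSegment hm
  have h1 : c - a ≠ 0 := sub_ne_zero.2 h.symm
  rw [← mem_closure_iff_nhdsWithin_neBot]
  have ht : Filter.Tendsto (fun ε : ℝ => a + (r + ε * Complex.I) * (c - a))
      (nhdsWithin 0 (Set.Ioi 0)) (nhds (a + r * (c - a))) := by
    have : Continuous (fun ε : ℝ => a + (r + ε * Complex.I) * (c - a)) := by fun_prop
    have h2 := this.tendsto 0
    simp only [Complex.ofReal_zero, zero_mul, add_zero] at h2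
    exact h2.mono_left nhdsWithin_le_nhds
  refine mem_closure_of_tendsto ht ?_
  filter_upwards [self_mem_nhdsWithin] with ε hε
  have : (a + (r + ε * Complex.I) * (c - a) - a) / (c - a) = r + ε * Complex.I := by
    field_simp
    ring
  rw [leftHalfPlane, Set.mem_ofPred_eq, this]
  simpa using hε

/-- The quotient is zero or negative real exactly when `z` sees `s` and `t` in opposite directions
or is an endpoint. Hence the principal logarithm in `windingSum` is holomorphic off the segment. -/
lemma div_mem_slitPlane {s t z : ℂ} (h : z ∉ segment ℝ s t) :
    (t - z) / (s - z) ∈ Complex.slitPlane := by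
  by_contra hq
  apply h
  have hs : s - z ≠ 0 := by
    intro h0
    rw [sub_eq_zero] at h0
    exact h (h0 ▸ left_mem_segment ℝ s t)
  rw [Complex.mem_slitPlane_iff_not_le_zero, not_not] at hq
  obtain ⟨r, hr, hq⟩ : ∃ r : ℝ, 0 ≤ r ∧ (t - z) / (s - z) = -(r : ℂ) := by
    rw [Complex.le_def] at hq
    refine ⟨-((t - z) / (s - z)).re, by simpa using hq.1, ?_⟩
    apply Complex.ext <;> simp [hq.2]
  rw [div_eq_iff hs] at hq
  have h1 : (1 + r : ℂ) ≠ 0 := by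
    have : (1 + r : ℝ) ≠ 0 := by positivity
    exact_mod_cast this
  rw [segment_eq_image']
  -- Solving `t - z = -r (s - z)` for `z` gives `z = (r s + t) / (1 + r)`.
  refine ⟨1 / (1 + r), ⟨by positivity, by rw [div_le_one (by positivity)]; linarith⟩, ?_⟩
  simp only [Complex.real_smul]
  push_cast
  field_simp
  linear_combination hq

/-! ### Winding sums: local constancy and jumps -/

section SegmentSystem

variable {ι : Type*} (s t : ι → ℂ)

/-- The weighted sum of the angles (in the form of complex logarithms) under which the segments
`[s i, t i]` are seen from `z`. -/
noncomputable def windingSum [Fintype ι] (Z : ι → ℂ) (z : ℂ) : ℂ :=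
  ∑ i, Z i * Complex.log ((t i - z) / (s i - z))

/-- The weights `Z` on the directed segments from `s i` to `t i` have zero net flow at every
point. -/
def IsFlow [Fintype ι] (Z : ι → ℂ) : Prop := ∀ g : ℂ → ℂ, ∑ i, Z i * (g (t i) - g (s i)) = 0

/-- Segments that meet pairwise only in common endpoints. -/
structure IsSegmentSystem : Prop where
  ne : ∀ i, s i ≠ t i
  inter_subset : ∀ i j, i ≠ j → segment ℝ (s i) (t i) ∩ segment ℝ (s j) (t j) ⊆ {s i, t i}

/-- `w` is the limit of `f` from the left at all inner points of the segment from `a` to `c`. -/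
def HasLeftLimit (f : ℂ → ℂ) (a c w : ℂ) : Prop :=
  ∀ m ∈ openSegment ℝ a c, Filter.Tendsto f (nhdsWithin m (leftHalfPlane a c)) (nhds w)

/-- `a` and `b` are the endpoints of the segment with index `i`. -/
def HasEnds (i : ι) (a b : ℂ) : Prop := (s i = a ∧ t i = b) ∨ (s i = b ∧ t i = a)

variable {s t}

lemma HasEnds.segment_eq {i : ι} {a b : ℂ} (h : HasEnds s t i a b) :
    segment ℝ (s i) (t i) = segment ℝ a b := by
  rcases h with ⟨rfl, rfl⟩ | ⟨rfl, rfl⟩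
  · rfl
  · exact segment_symm ℝ _ _

lemma HasEnds.ne (hS : IsSegmentSystem s t) {i : ι} {a b : ℂ} (h : HasEnds s t i a b) :
    a ≠ b := by
  rcases h with ⟨rfl, rfl⟩ | ⟨rfl, rfl⟩
  · exact hS.ne i
  · exact (hS.ne i).symm

lemma IsSegmentSystem.notMem_of_mem_openSegment (hS : IsSegmentSystem s t) {i j : ι}
    (hij : j ≠ i) {m : ℂ} (hm : m ∈ openSegment ℝ (s i) (t i)) :
    m ∉ segment ℝ (s j) (t j) := by
  intro hj
  have h := hS.inter_subset i j hij.symm ⟨openSegment_subset_segment ℝ _ _ hm, hj⟩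
  rcases h with h | h
  · rw [h, left_mem_openSegment_iff] at hm
    exact hS.ne i hm
  · rw [h, right_mem_openSegment_iff] at hm
    exact hS.ne i hm

variable [Fintype ι]

/-- Each term contributes `Z i` times the difference of `-(x - z)⁻¹` between the two endpoints, and
the flow condition for this test function makes the sum vanish. -/
lemma windingSum_hasDerivAt {Z : ι → ℂ} (hZ : IsFlow s t Z) {z : ℂ}
    (hz : ∀ i, z ∉ segment ℝ (s i) (t i)) : HasDerivAt (windingSum s t Z) 0 z := by
  have key : ∀ i, HasDerivAt (fun z => Z i * Complex.log ((t i - z) / (s i - z)))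
      (Z i * (-(t i - z)⁻¹ - -(s i - z)⁻¹)) z := by
    intro i
    have hs : s i - z ≠ 0 := by
      intro h0
      rw [sub_eq_zero] at h0
      exact hz i (h0 ▸ left_mem_segment ℝ _ _)
    have ht : t i - z ≠ 0 := by
      intro h0
      rw [sub_eq_zero] at h0
      exact hz i (h0 ▸ right_mem_segment ℝ _ _)
    have h1 : HasDerivAt (fun z => t i - z) (-1) z := by
      simpa using (hasDerivAt_id z).const_sub (t i)
    have h2 : HasDerivAt (fun z => s i - z) (-1) z := by
      simpa using (hasDerivAt_id z).const_sub (s i)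
    have h3 := ((h1.div h2 hs).clog (div_mem_slitPlane (hz i))).const_mul (Z i)
    have hv : Z i * (-(t i - z)⁻¹ - -(s i - z)⁻¹) = Z i *
        ((-1 * (s i - z) - (t i - z) * -1) / (s i - z) ^ 2 / ((t i - z) / (s i - z))) := by
      field_simp
    rw [hv]
    exact h3
  have h := HasDerivAt.fun_sum (u := Finset.univ) (fun i _ => key i)
  have h0 : ∑ i, Z i * (-(t i - z)⁻¹ - -(s i - z)⁻¹) = 0 := hZ fun x => -(x - z)⁻¹
  rw [h0] at h
  exact h

lemma eventually_notMem_segment {z : ℂ} {p : ι → Prop}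
    (hz : ∀ i, p i → z ∉ segment ℝ (s i) (t i)) :
    ∀ᶠ y in nhds z, ∀ i, p i → y ∉ segment ℝ (s i) (t i) := by
  rw [Filter.eventually_all]
  intro i
  by_cases hi : p i
  · filter_upwards [(isClosed_segment (s i) (t i)).isOpen_compl.mem_nhds (hz i hi)] with y hy _
    exact hy
  · exact Filter.Eventually.of_forall fun _ h => absurd h hi

lemma windingSum_eq_of_isPreconnected {Z : ι → ℂ} (hZ : IsFlow s t Z) {S : Set ℂ}
    (hS : IsPreconnected S) (hd : ∀ z ∈ S, ∀ i, z ∉ segment ℝ (s i) (t i)) {x y : ℂ}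
    (hx : x ∈ S) (hy : y ∈ S) : windingSum s t Z x = windingSum s t Z y := by
  refine hS.induction₂ (fun x y => windingSum s t Z x = windingSum s t Z y) ?_
    (fun _ _ _ _ _ _ h h' => h.trans h') (fun _ _ _ _ h => h.symm) hx hy
  intro x hx
  apply Filter.Eventually.filter_mono nhdsWithin_le_nhds
  have h := eventually_notMem_segment (p := fun _ => True) (fun i _ => hd x hx i)
  obtain ⟨r, hr, hb⟩ := Metric.eventually_nhds_iff_ball.1 h
  filter_upwards [Metric.ball_mem_nhds x hr] with y hy
  have hD : ∀ z ∈ Metric.ball x r, HasDerivAt (windingSum s t Z) 0 z := fun z hz =>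
    windingSum_hasDerivAt hZ (fun i => hb z hz i trivial)
  exact Metric.isOpen_ball.is_const_of_deriv_eq_zero (convex_ball x r).isPreconnected
    (fun z hz => (hD z hz).differentiableAt.differentiableWithinAt)
    (fun z hz => (hD z hz).deriv) (Metric.mem_ball_self hr) hy

/-- The two one-sided limits at an inner point of a segment. -/
lemma IsSegmentSystem.tendsto_windingSum (hS : IsSegmentSystem s t) (Z : ι → ℂ) (i : ι) {m : ℂ}
    (hm : m ∈ openSegment ℝ (s i) (t i)) :
    Filter.Tendsto (windingSum s t Z) (nhdsWithin m (leftHalfPlane (s i) (t i)))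
      (nhds (windingSum s t Z m)) ∧
    Filter.Tendsto (windingSum s t Z) (nhdsWithin m (leftHalfPlane (t i) (s i)))
      (nhds (windingSum s t Z m - 2 * Real.pi * Complex.I * Z i)) := by
  classical
  have hsplit : ∀ z, windingSum s t Z z = Z i * Complex.log ((t i - z) / (s i - z)) +
      ∑ j ∈ Finset.univ.erase i, Z j * Complex.log ((t j - z) / (s j - z)) := fun z =>
    (Finset.add_sum_erase _ _ (Finset.mem_univ i)).symm
  have hcont : ContinuousAt (fun z => ∑ j ∈ Finset.univ.erase i,
      Z j * Complex.log ((t j - z) / (s j - z))) m := by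
    refine tendsto_finsetSum _ fun j hj => ?_
    have hmj := hS.notMem_of_mem_openSegment (Finset.ne_of_mem_erase hj) hm
    have hs : s j - m ≠ 0 := by
      intro h0
      rw [sub_eq_zero] at h0
      exact hmj (h0 ▸ left_mem_segment ℝ _ _)
    have h1 : ContinuousAt (fun z => (t j - z) / (s j - z)) m :=
      ContinuousAt.div (by fun_prop) (by fun_prop) hs
    exact (h1.clog (div_mem_slitPlane hmj)).const_mul (Z j)
  obtain ⟨r, h0, h1, hmr⟩ := exists_of_mem_openSegment hm
  have hne : t i - s i ≠ 0 := sub_ne_zero.2 (hS.ne i).symm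
  have hr0 : (r : ℂ) ≠ 0 := by exact_mod_cast h0.ne'
  have hsm : s i - m ≠ 0 := by
    rw [hmr]
    simpa using And.intro h0.ne' hne
  have hq : (t i - m) / (s i - m) = ((-((1 - r) / r) : ℝ) : ℂ) := by
    rw [div_eq_iff hsm, hmr]
    push_cast
    field_simp
    ring
  have hpos : 0 < (1 - r) / r := div_pos (by linarith) h0
  have hre : ((t i - m) / (s i - m)).re < 0 := by
    rw [hq, Complex.ofReal_re]
    linarith
  have him : ((t i - m) / (s i - m)).im = 0 := by rw [hq, Complex.ofReal_im]
  have hqc : ContinuousAt (fun z => (t i - z) / (s i - z)) m :=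
    ContinuousAt.div (by fun_prop) (by fun_prop) hsm
  -- With `ζ = (z - s)/(t - s)` the quotient is `1 - 1/ζ`, whose imaginary part has the sign of that
  -- of `ζ`. So the left side of the segment goes to the upper half-plane, the right side to the
  -- lower one.
  have hform : ∀ z, s i - z ≠ 0 → ((t i - z) / (s i - z)).im =
      ((z - s i) / (t i - s i)).im / Complex.normSq ((z - s i) / (t i - s i)) := by
    intro z hz
    have hz' : z - s i ≠ 0 := by
      rw [← neg_sub]
      exact neg_ne_zero.2 hz
    have : (t i - z) / (s i - z) = 1 - ((z - s i) / (t i - s i))⁻¹ := by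
      field_simp
      ring
    rw [this]
    simp only [Complex.sub_im, Complex.one_im, Complex.inv_im]
    ring
  have hzev : ∀ᶠ z in nhds m, s i - z ≠ 0 :=
    (show ContinuousAt (fun z => s i - z) m by fun_prop).eventually_ne hsm
  have hnorm : ∀ z, s i - z ≠ 0 → 0 < Complex.normSq ((z - s i) / (t i - s i)) := by
    intro z hz
    rw [Complex.normSq_pos]
    refine div_ne_zero ?_ hne
    rw [← neg_sub]
    exact neg_ne_zero.2 hz
  constructor
  -- On the negative axis the principal logarithm has argument `π`, its limit from above. Thus the
  -- value of `windingSum` on the segment itself is already the left limit, and approach from below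
  -- costs `2πi`.
  · have hleft : Filter.Tendsto (fun z => (t i - z) / (s i - z))
        (nhdsWithin m (leftHalfPlane (s i) (t i)))
        (nhdsWithin ((t i - m) / (s i - m)) {z | 0 ≤ z.im}) := by
      refine tendsto_nhdsWithin_iff.2 ⟨hqc.mono_left nhdsWithin_le_nhds, ?_⟩
      filter_upwards [self_mem_nhdsWithin, hzev.filter_mono nhdsWithin_le_nhds] with z hz hz0
      rw [hform z hz0]
      exact (div_pos hz (hnorm z hz0)).le
    have hlog := (Complex.continuousWithinAt_log_of_re_neg_of_im_zero hre him).tendsto.comp hleft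
    have := (hlog.const_mul (Z i)).add (hcont.tendsto.mono_left nhdsWithin_le_nhds)
    rw [← hsplit m] at this
    exact this.congr fun z => (hsplit z).symm
  · have hright : Filter.Tendsto (fun z => (t i - z) / (s i - z))
        (nhdsWithin m (leftHalfPlane (t i) (s i)))
        (nhdsWithin ((t i - m) / (s i - m)) {z | z.im < 0}) := by
      refine tendsto_nhdsWithin_iff.2 ⟨hqc.mono_left nhdsWithin_le_nhds, ?_⟩
      rw [leftHalfPlane_swap (hS.ne i)]
      filter_upwards [self_mem_nhdsWithin, hzev.filter_mono nhdsWithin_le_nhds] with z hz hz0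
      rw [hform z hz0]
      exact div_neg_of_neg_of_pos hz (hnorm z hz0)
    have hlog :=
      (Complex.tendsto_log_nhdsWithin_im_neg_of_re_neg_of_im_zero hre him).comp hright
    have h2 := (hlog.const_mul (Z i)).add (hcont.tendsto.mono_left nhdsWithin_le_nhds)
    have harg : Complex.arg ((t i - m) / (s i - m)) = Real.pi :=
      Complex.arg_eq_pi_iff.2 ⟨hre, him⟩
    have hval : windingSum s t Z m - 2 * Real.pi * Complex.I * Z i =
        Z i * (Real.log ‖(t i - m) / (s i - m)‖ - Real.pi * Complex.I) +
        ∑ j ∈ Finset.univ.erase i, Z j * Complex.log ((t j - m) / (s j - m)) := by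
      rw [hsplit m, Complex.log, harg]
      ring
    rw [hval]
    exact h2.congr fun z => (hsplit z).symm

/-- The winding sum of a flow has one-sided limits along each segment, and the jump across the
segment is determined by its weight. -/
lemma IsSegmentSystem.exists_hasLeftLimit (hS : IsSegmentSystem s t) {Z : ι → ℂ}
    (hZ : IsFlow s t Z) (i : ι) :
    ∃ w, HasLeftLimit (windingSum s t Z) (s i) (t i) w ∧
      HasLeftLimit (windingSum s t Z) (t i) (s i) (w - 2 * Real.pi * Complex.I * Z i) := by
  have hne := hS.ne i
  have hconst : ∀ m ∈ openSegment ℝ (s i) (t i), ∀ m' ∈ openSegment ℝ (s i) (t i),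
      windingSum s t Z m = windingSum s t Z m' := by
    intro m hm m' hm'
    refine (convex_openSegment (s i) (t i)).isPreconnected.induction₂
      (fun x y => windingSum s t Z x = windingSum s t Z y) ?_
      (fun _ _ _ _ _ _ h h' => h.trans h') (fun _ _ _ _ h => h.symm) hm hm'
    intro x hx
    have h := eventually_notMem_segment (p := fun j => j ≠ i)
      (fun j hj => hS.notMem_of_mem_openSegment hj hx)
    obtain ⟨r, hr, hb⟩ := Metric.eventually_nhds_iff_ball.1 h
    have hpre : IsPreconnected (Metric.ball x r ∩ leftHalfPlane (s i) (t i)) :=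
      ((convex_ball x r).inter (convex_leftHalfPlane _ _)).isPreconnected
    have hdis : ∀ z ∈ Metric.ball x r ∩ leftHalfPlane (s i) (t i),
        ∀ j, z ∉ segment ℝ (s j) (t j) := by
      intro z hz j hzj
      by_cases hj : j = i
      · subst hj
        exact notMem_leftHalfPlane_of_mem_segment hne hzj hz.2
      · exact hb z hz.1 j hj hzj
    have hnb := nhdsWithin_leftHalfPlane_neBot hne hx
    have hmem : ∀ y ∈ Metric.ball x r, ∀ᶠ z in nhdsWithin y (leftHalfPlane (s i) (t i)),
        z ∈ Metric.ball x r ∩ leftHalfPlane (s i) (t i) := fun y hy => by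
      filter_upwards [self_mem_nhdsWithin,
        mem_nhdsWithin_of_mem_nhds (Metric.isOpen_ball.mem_nhds hy)] with z h1 h2
      exact ⟨h2, h1⟩
    -- The half-disc at `x` avoids all segments, so the sum is constant there; its value at `z0` is
    -- the left limit at every nearby point of the segment.
    obtain ⟨z0, hz0⟩ := (hmem x (Metric.mem_ball_self hr)).exists
    have hlim : ∀ y ∈ Metric.ball x r, y ∈ openSegment ℝ (s i) (t i) →
        windingSum s t Z y = windingSum s t Z z0 := by
      intro y hy hys
      have hnb := nhdsWithin_leftHalfPlane_neBot hne hys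
      refine tendsto_nhds_unique (hS.tendsto_windingSum Z i hys).1
        (tendsto_const_nhds.congr' ?_)
      filter_upwards [hmem y hy] with z hz
      exact windingSum_eq_of_isPreconnected hZ hpre hdis hz0 hz
    filter_upwards [self_mem_nhdsWithin,
      mem_nhdsWithin_of_mem_nhds (Metric.ball_mem_nhds x hr)] with y hy1 hy2
    rw [hlim x (Metric.mem_ball_self hr) hx, hlim y hy2 hy1]
  have hmid := add_mul_mem_openSegment (s i) (t i) (r := 1 / 2) (by norm_num) (by norm_num)
  refine ⟨windingSum s t Z (s i + (1 / 2 : ℝ) * (t i - s i)), fun m hm => ?_, fun m hm => ?_⟩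
  · exact hconst m hm _ hmid ▸ (hS.tendsto_windingSum Z i hm).1
  · rw [openSegment_symm] at hm
    exact hconst m hm _ hmid ▸ (hS.tendsto_windingSum Z i hm).2

end SegmentSystem

/-! ### Passing around an endpoint to the next segment -/

section Sector

open Filter Topology

/-- The angle by which a ray from `a` through `z` has to be turned counterclockwise to pass
through `b`, minus `π`. -/
noncomputable def turnAngle (a b z : ℂ) : ℝ := Complex.arg (-((b - a) / (z - a)))

lemma turnAngle_add_mul (a b c : ℂ) {r : ℝ} (hr : 0 < r) :
    turnAngle a b (a + r * (c - a)) = turnAngle a b c := by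
  unfold turnAngle
  have : -((b - a) / (a + r * (c - a) - a)) = ((r⁻¹ : ℝ) : ℂ) * (-((b - a) / (c - a))) := by
    push_cast
    rw [add_sub_cancel_left, div_mul_eq_div_div_swap, div_eq_mul_inv _ (r : ℂ)]
    ring
  rw [this, Complex.arg_real_mul _ (inv_pos.2 hr)]

lemma turnAngle_self {a b : ℂ} (hab : a ≠ b) : turnAngle a b b = Real.pi := by
  rw [turnAngle, div_self (sub_ne_zero.2 hab.symm), Complex.arg_neg_one]

/-- The open circular sector at `a` that ends at the direction of `b`. -/
def sector (a b : ℂ) (r θ : ℝ) : Set ℂ := {z | z ≠ a ∧ dist z a < r ∧ turnAngle a b z < θ}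

/-- In polar coordinates around `a` the sector is the continuous image of an open rectangle. -/
lemma isPreconnected_sector {a b : ℂ} (hab : a ≠ b) {r θ : ℝ} (hθ : θ ≤ Real.pi) :
    IsPreconnected (sector a b r θ) := by
  have hba : b - a ≠ 0 := sub_ne_zero.2 hab.symm
  have hn : 0 < ‖b - a‖ := norm_pos_iff.2 hba
  have himg : sector a b r θ = (fun p : ℝ × ℝ => a - p.1 * (b - a) * Complex.exp (-p.2 * Complex.I))
      '' (Set.Ioo 0 (r / ‖b - a‖) ×ˢ Set.Ioo (-Real.pi) θ) := by
    ext z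
    constructor
    · rintro ⟨hza, hzr, hzθ⟩
      have hza' : z - a ≠ 0 := sub_ne_zero.2 hza
      refine ⟨(‖z - a‖ / ‖b - a‖, turnAngle a b z), ⟨⟨?_, ?_⟩, Complex.neg_pi_lt_arg _, hzθ⟩, ?_⟩
      · exact div_pos (norm_pos_iff.2 hza') hn
      · rw [dist_eq_norm] at hzr
        exact div_lt_div_of_pos_right hzr hn
      · have h1 := Complex.norm_mul_exp_arg_mul_I (-((b - a) / (z - a)))
        have h2 : ‖-((b - a) / (z - a))‖ = ‖b - a‖ / ‖z - a‖ := by simp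
        rw [h2] at h1
        change ((‖b - a‖ / ‖z - a‖ : ℝ) : ℂ) * Complex.exp (turnAngle a b z * Complex.I) = _ at h1
        have h3 : Complex.exp (-turnAngle a b z * Complex.I) =
            (Complex.exp (turnAngle a b z * Complex.I))⁻¹ := by
          rw [← Complex.exp_neg]
          ring_nf
        have h4 := Complex.exp_ne_zero (turnAngle a b z * Complex.I)
        have hzn : (‖z - a‖ : ℂ) ≠ 0 := by exact_mod_cast (norm_pos_iff.2 hza').ne'
        have hbn : (‖b - a‖ : ℂ) ≠ 0 := by exact_mod_cast hn.ne'
        simp only [h3]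
        push_cast at h1 ⊢
        rw [div_mul_eq_mul_div, div_eq_iff hzn] at h1
        have h5 : ‖b - a‖ * Complex.exp (turnAngle a b z * Complex.I) * (z - a) =
            -(b - a) * ‖z - a‖ := by
          rw [h1]
          field_simp
        field_simp
        linear_combination -h5
    · rintro ⟨⟨ρ, τ⟩, ⟨⟨h0, hr⟩, hτ, hτθ⟩, rfl⟩
      have hρ : (ρ : ℂ) ≠ 0 := by exact_mod_cast h0.ne'
      have he := Complex.exp_ne_zero (-τ * Complex.I)
      have hsub : (a - ρ * (b - a) * Complex.exp (-τ * Complex.I)) - a =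
        -(ρ * (b - a) * Complex.exp (-τ * Complex.I)) := by ring
      refine ⟨?_, ?_, ?_⟩
      · rw [← sub_ne_zero]
        simp only [hsub]
        exact neg_ne_zero.2 (mul_ne_zero (mul_ne_zero hρ hba) he)
      · rw [dist_eq_norm]
        simp only [hsub]
        have : ‖Complex.exp (-τ * Complex.I)‖ = 1 := by
          have := Complex.norm_exp_ofReal_mul_I (-τ)
          simpa using this
        rw [norm_neg, norm_mul, norm_mul, this, Complex.norm_real, Real.norm_of_nonneg h0.le,
          mul_one]
        exact (lt_div_iff₀ hn).1 hr
      · simp only [turnAngle, hsub]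
        have : -((b - a) / -(ρ * (b - a) * Complex.exp (-τ * Complex.I))) =
            ((ρ⁻¹ : ℝ) : ℂ) * (Complex.cos τ + Complex.sin τ * Complex.I) := by
          rw [← Complex.exp_mul_I, neg_mul, Complex.exp_neg]
          push_cast
          field_simp
        rw [this, Complex.arg_mul_cos_add_sin_mul_I (inv_pos.2 h0)
          ⟨hτ, (hτθ.trans_le hθ).le⟩]
        exact hτθ
  rw [himg]
  refine IsPreconnected.image ?_ _ (by fun_prop)
  exact ((convex_Ioo _ _).prod (convex_Ioo _ _)).isPreconnected

lemma eventually_ne_and_dist_lt {a c : ℂ} (hac : a ≠ c) {r ρ : ℝ} (h0 : 0 < ρ)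
    (hr : ρ * ‖c - a‖ < r) : ∀ᶠ z in 𝓝 (a + ρ * (c - a)), z ≠ a ∧ dist z a < r := by
  have hca : c - a ≠ 0 := sub_ne_zero.2 hac.symm
  have hρ : (ρ : ℂ) ≠ 0 := by exact_mod_cast h0.ne'
  refine Filter.Eventually.and ?_ ?_
  · refine continuousAt_id.eventually_ne ?_
    simp only [id]
    rw [Ne, add_eq_left]
    exact mul_ne_zero hρ hca
  · refine Metric.isOpen_ball.mem_nhds ?_
    rw [Metric.mem_ball, dist_eq_norm, add_sub_cancel_left, norm_mul, Complex.norm_real,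
      Real.norm_of_nonneg h0.le]
    exact hr

/-- Points near the right side of `[a, b]` lie in the sector. -/
lemma eventually_mem_sector_right {a b : ℂ} (hab : a ≠ b) {r θ ρ : ℝ} (hθ : -Real.pi < θ)
    (h0 : 0 < ρ) (hr : ρ * ‖b - a‖ < r) :
    ∀ᶠ z in 𝓝[leftHalfPlane b a] (a + ρ * (b - a)), z ∈ sector a b r θ := by
  have hba : b - a ≠ 0 := sub_ne_zero.2 hab.symm
  have hρ : (ρ : ℂ) ≠ 0 := by exact_mod_cast h0.ne'
  set m := a + ρ * (b - a) with hm
  have hma : m - a ≠ 0 := by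
    rw [hm, add_sub_cancel_left]
    exact mul_ne_zero hρ hba
  have hval : -((b - a) / (m - a)) = ((-ρ⁻¹ : ℝ) : ℂ) := by
    rw [hm, add_sub_cancel_left]
    push_cast
    field_simp
  have hd : ContinuousAt (fun z => (b - a) / (z - a)) m :=
    ContinuousAt.div (by fun_prop) (by fun_prop) hma
  have hc : ContinuousAt (fun z => -((b - a) / (z - a))) m := hd.neg
  have hne := eventually_ne_and_dist_lt hab h0 hr
  have ht : Tendsto (fun z => -((b - a) / (z - a))) (𝓝[leftHalfPlane b a] m)
      (𝓝[{z | z.im < 0}] (-((b - a) / (m - a)))) := by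
    refine tendsto_nhdsWithin_iff.2 ⟨hc.mono_left nhdsWithin_le_nhds, ?_⟩
    rw [leftHalfPlane_swap hab]
    filter_upwards [self_mem_nhdsWithin, hne.filter_mono nhdsWithin_le_nhds] with z hz hz'
    change ((z - a) / (b - a)).im < 0 at hz
    have hza : z - a ≠ 0 := sub_ne_zero.2 hz'.1
    rw [← inv_div, Complex.neg_im, Complex.inv_im, neg_div, neg_neg]
    exact div_neg_of_neg_of_pos hz (Complex.normSq_pos.2 (div_ne_zero hza hba))
  have harg := (Complex.tendsto_arg_nhdsWithin_im_neg_of_re_neg_of_im_zero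
    (by rw [hval, Complex.ofReal_re]; exact neg_neg_of_pos (inv_pos.2 h0))
    (by rw [hval, Complex.ofReal_im])).comp ht
  filter_upwards [harg.eventually_lt_const hθ, hne.filter_mono nhdsWithin_le_nhds] with z h1 h2
  exact ⟨h2.1, h2.2, h1⟩

/-- Points near the left side of `[a, c]` lie in the sector that begins at the direction of
`c`. -/
lemma eventually_mem_sector_left {a b c : ℂ} (hab : a ≠ b) (hac : a ≠ c) {r ρ : ℝ}
    (h0 : 0 < ρ) (hr : ρ * ‖c - a‖ < r) :
    ∀ᶠ z in 𝓝[leftHalfPlane a c] (a + ρ * (c - a)), z ∈ sector a b r (turnAngle a b c) := by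
  have hba : b - a ≠ 0 := sub_ne_zero.2 hab.symm
  have hca : c - a ≠ 0 := sub_ne_zero.2 hac.symm
  have hval : (a + ρ * (c - a) - a) / (c - a) = (ρ : ℂ) := by
    rw [add_sub_cancel_left]
    field_simp
  have hc : ContinuousAt (fun z => Complex.arg ((z - a) / (c - a))) (a + ρ * (c - a)) := by
    refine ContinuousAt.comp (g := Complex.arg) ?_ (by fun_prop)
    rw [hval]
    exact Complex.continuousAt_arg (Complex.ofReal_mem_slitPlane.2 h0)
  have hpos : 0 < turnAngle a b c + Real.pi := by
    have := Complex.neg_pi_lt_arg (-((b - a) / (c - a)))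
    unfold turnAngle
    linarith
  -- Near the ray the argument of `ζ` is less than the opening of the sector, so subtracting it
  -- below does not wrap past `-π`.
  have hlt := hc.tendsto.eventually_lt_const (u := turnAngle a b c + Real.pi) (by
    rw [hval, Complex.arg_ofReal_of_nonneg h0.le]
    exact hpos)
  filter_upwards [self_mem_nhdsWithin, (eventually_ne_and_dist_lt hac h0 hr).filter_mono
    nhdsWithin_le_nhds, hlt.filter_mono nhdsWithin_le_nhds] with z hz hz' hzlt
  refine ⟨hz'.1, hz'.2, ?_⟩
  have hza : z - a ≠ 0 := sub_ne_zero.2 hz'.1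
  set ζ := (z - a) / (c - a) with hζ
  have hz0 : 0 < ζ.im := hz
  have hζ0 : ζ ≠ 0 := div_ne_zero hza hca
  have hargpos : 0 < Complex.arg ζ := by
    rcases (Complex.arg_nonneg_iff.2 hz0.le).eq_or_lt with h | h
    · have := (Complex.arg_eq_zero_iff.1 h.symm).2
      exact absurd this hz0.ne'
    · exact h
  have hargne : Complex.arg ζ ≠ Real.pi := by
    intro h
    exact hz0.ne' (Complex.arg_eq_pi_iff.1 h).2
  have hinv : Complex.arg ζ⁻¹ = -Complex.arg ζ := by
    rw [Complex.arg_inv, if_neg hargne]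
  have hprod : -((b - a) / (z - a)) = -((b - a) / (c - a)) * ζ⁻¹ := by
    rw [hζ]
    field_simp
  have hle := Complex.arg_le_pi (-((b - a) / (c - a)))
  have hmul := Complex.arg_mul (x := -((b - a) / (c - a))) (y := ζ⁻¹)
    (neg_ne_zero.2 (div_ne_zero hba hca)) (inv_ne_zero hζ0)
    (by
      rw [hinv]
      unfold turnAngle at hzlt
      constructor <;> linarith)
  rw [turnAngle, hprod, hmul, hinv]
  unfold turnAngle
  linarith

variable {ι : Type*} {s t : ι → ℂ}

/-- At each endpoint `a` of a segment `[b, a]` at which other segments end, there is another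
segment `[a, c]` such that the left sides of `[b, a]` and `[a, c]` are connected near `a`. -/
lemma IsSegmentSystem.exists_next [Fintype ι] (hS : IsSegmentSystem s t) {i : ι} {a b : ℂ}
    (hi : HasEnds s t i a b) (hex : ∃ j ≠ i, ∃ c, HasEnds s t j a c) :
    ∃ j ≠ i, ∃ c, HasEnds s t j a c ∧ ∀ Z, IsFlow s t Z → ∀ w w',
      HasLeftLimit (windingSum s t Z) b a w → HasLeftLimit (windingSum s t Z) a c w' →
      w = w' := by
  classical
  have hab := hi.ne hS
  let T : Set (ι × ℂ) := {p | p.1 ≠ i ∧ HasEnds s t p.1 a p.2}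
  have hTfin : T.Finite := by
    refine Set.Finite.subset (((Set.finite_range (fun j => (j, s j)))).union
      (Set.finite_range (fun j => (j, t j)))) ?_
    rintro ⟨j, c⟩ ⟨-, h | h⟩
    · exact Or.inr ⟨j, Prod.ext rfl h.2⟩
    · exact Or.inl ⟨j, Prod.ext rfl h.1⟩
  -- The minimal turning angle selects the first segment met clockwise from `b` around `a`, on the
  -- left of the direction from `b` to `a`.
  obtain ⟨⟨j, c⟩, ⟨hji, hj⟩, hmin⟩ := hTfin.exists_minimalFor (fun p => turnAngle a b p.2) T
    (by obtain ⟨j, hj, c, hc⟩ := hex; exact ⟨(j, c), hj, hc⟩)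
  have hmin' : ∀ k c', k ≠ i → HasEnds s t k a c' → turnAngle a b c ≤ turnAngle a b c' := by
    intro k c' hk hc'
    rcases le_total (turnAngle a b c) (turnAngle a b c') with h | h
    · exact h
    · exact hmin (j := (k, c')) ⟨hk, hc'⟩ h
  refine ⟨j, hji, c, hj, fun Z hZ w w' hw hw' => ?_⟩
  have hac := hj.ne hS
  have hev := eventually_notMem_segment (s := s) (t := t) (z := a)
    (p := fun k => a ∉ segment ℝ (s k) (t k)) (fun k hk => hk)
  obtain ⟨r, hr, hb⟩ := Metric.eventually_nhds_iff_ball.1 hev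
  have hends : ∀ k, a ∈ segment ℝ (s k) (t k) → ∃ c', HasEnds s t k a c' := by
    intro k hk
    by_cases hki : k = i
    · exact ⟨b, hki ▸ hi⟩
    · have hai : a ∈ segment ℝ (s i) (t i) := by
        rw [hi.segment_eq]
        exact left_mem_segment ℝ a b
      rcases hS.inter_subset k i hki ⟨hk, hai⟩ with h | h
      · exact ⟨t k, Or.inl ⟨h.symm, rfl⟩⟩
      · exact ⟨s k, Or.inr ⟨rfl, h.symm⟩⟩
  -- A segment meeting the small sector must end at `a`. It is then a ray there whose angle is at
  -- least that of `c` by minimality, or `π` for the segment `i`.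
  have hdis : ∀ z ∈ sector a b r (turnAngle a b c), ∀ k, z ∉ segment ℝ (s k) (t k) := by
    rintro z ⟨hza, hzr, hzθ⟩ k hzk
    obtain ⟨c', hc'⟩ : ∃ c', HasEnds s t k a c' := by
      by_contra hno
      exact hb z hzr k (fun h => hno (hends k h)) hzk
    rw [hc'.segment_eq] at hzk
    obtain ⟨x, hx0, -, rfl⟩ := exists_of_mem_segment hzk
    have hx : 0 < x := by
      rcases hx0.eq_or_lt with rfl | h
      · simp at hza
      · exact h
    rw [turnAngle_add_mul a b c' hx] at hzθ
    by_cases hki : k = i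
    · subst hki
      have hbc : c' = b := by
        rcases hi with h | h <;> rcases hc' with h' | h'
        · rw [← h.2, ← h'.2]
        · exact absurd (h'.2.trans h.1.symm) (hS.ne _).symm
        · exact absurd (h.2.trans h'.1.symm) (hS.ne _).symm
        · rw [← h.1, ← h'.1]
      rw [hbc, turnAngle_self hab] at hzθ
      exact absurd hzθ (not_lt.2 (Complex.arg_le_pi _))
    · exact absurd hzθ (not_lt.2 (hmin' k c' hki hc'))
  obtain ⟨ρ, hρ0, hρ1, hρb, hρc⟩ :
      ∃ ρ : ℝ, 0 < ρ ∧ ρ < 1 ∧ ρ * ‖b - a‖ < r ∧ ρ * ‖c - a‖ < r := by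
    have h1 : ∀ x : ℝ, ∀ᶠ ρ : ℝ in 𝓝[>] 0, ρ * x < r := by
      intro x
      have : Tendsto (fun ρ : ℝ => ρ * x) (𝓝 0) (𝓝 (0 * x)) :=
        (continuous_id.mul continuous_const).tendsto 0
      rw [zero_mul] at this
      exact (this.eventually_lt_const hr).filter_mono nhdsWithin_le_nhds
    have h2 : ∀ᶠ ρ : ℝ in 𝓝[>] 0, ρ < 1 :=
      (eventually_lt_nhds one_pos).filter_mono nhdsWithin_le_nhds
    have h3 : ∀ᶠ ρ : ℝ in 𝓝[>] 0, 0 < ρ := self_mem_nhdsWithin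
    exact (h3.and (h2.and ((h1 _).and (h1 _)))).exists
  have hright := eventually_mem_sector_right (θ := turnAngle a b c) hab
    (Complex.neg_pi_lt_arg _) hρ0 hρb
  have hleft := eventually_mem_sector_left hab hac hρ0 hρc
  have hmb : a + ρ * (b - a) ∈ openSegment ℝ b a := by
    rw [openSegment_symm]
    exact add_mul_mem_openSegment a b hρ0 hρ1
  have hmc := add_mul_mem_openSegment a c hρ0 hρ1
  have hnb := nhdsWithin_leftHalfPlane_neBot hab.symm hmb
  have hnc := nhdsWithin_leftHalfPlane_neBot hac hmc
  have hpre := isPreconnected_sector hab (r := r) (θ := turnAngle a b c) (Complex.arg_le_pi _)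
  obtain ⟨z0, hz0⟩ := hleft.exists
  have e1 : w = windingSum s t Z z0 := tendsto_nhds_unique (hw _ hmb)
    (tendsto_const_nhds.congr' (by
      filter_upwards [hright] with z hz
      exact windingSum_eq_of_isPreconnected hZ hpre hdis hz0 hz))
  have e2 : w' = windingSum s t Z z0 := tendsto_nhds_unique (hw' _ hmc)
    (tendsto_const_nhds.congr' (by
      filter_upwards [hleft] with z hz
      exact windingSum_eq_of_isPreconnected hZ hpre hdis hz0 hz))
  rw [e1, e2]

end Sector

/-! ### Girth and discharging -/

namespace SimpleGraph

variable {V : Type*} {G : SimpleGraph V}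

/-- The walk along a sequence of consecutively adjacent vertices. -/
def walkOfSeq (v : ℕ → V) (h : ∀ k, G.Adj (v k) (v (k + 1))) (i : ℕ) :
    (n : ℕ) → G.Walk (v i) (v (i + n))
  | 0 => Walk.nil
  | n + 1 => (walkOfSeq v h i n).concat (h (i + n))

lemma length_walkOfSeq (v : ℕ → V) (h : ∀ k, G.Adj (v k) (v (k + 1))) (i n : ℕ) :
    (walkOfSeq v h i n).length = n := by
  induction n with
  | zero => rfl
  | succ n ih => rw [walkOfSeq, Walk.length_concat, ih]

lemma support_walkOfSeq (v : ℕ → V) (h : ∀ k, G.Adj (v k) (v (k + 1))) (i n : ℕ) :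
    (walkOfSeq v h i n).support = (List.range (n + 1)).map (fun k => v (i + k)) := by
  induction n with
  | zero => simp [walkOfSeq]
  | succ n ih =>
    rw [walkOfSeq, Walk.support_concat, ih, List.range_succ (n := n + 1), List.map_append]
    simp

lemma edges_walkOfSeq (v : ℕ → V) (h : ∀ k, G.Adj (v k) (v (k + 1))) (i n : ℕ) :
    (walkOfSeq v h i n).edges = (List.range n).map (fun k => s(v (i + k), v (i + k + 1))) := by
  induction n with
  | zero => simp [walkOfSeq]
  | succ n ih =>
    rw [walkOfSeq, Walk.edges_concat, ih, List.range_succ, List.map_append]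
    simp [add_assoc]

/-- A non-backtracking sequence of adjacent vertices that is shorter than the girth does not
visit a vertex twice. -/
lemma ne_of_lt_egirth {v : ℕ → V} (h : ∀ k, G.Adj (v k) (v (k + 1)))
    (hb : ∀ k, v (k + 2) ≠ v k) {g : ℕ} (hg : (g : ℕ∞) ≤ G.egirth) (n : ℕ) (h0 : 0 < n)
    (hn : n < g) (i : ℕ) : v i ≠ v (i + n) := by
  induction n using Nat.strong_induction_on generalizing i with
  | _ n ih =>
    intro heq
    have hn1 : n ≠ 1 := by
      rintro rfl
      exact (h i).ne heq
    have hn2 : n ≠ 2 := by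
      rintro rfl
      exact hb i heq.symm
    obtain ⟨m, rfl⟩ : ∃ m, n = m + 3 := ⟨n - 3, by omega⟩
    have hinj : ∀ k l, k < m + 3 → l < m + 3 → v (i + k) = v (i + l) → k = l := by
      intro k l hk hl hkl
      rcases lt_trichotomy k l with hlt | rfl | hlt
      · refine absurd hkl ?_
        have := ih (l - k) (by omega) (by omega) (by omega) (i + k)
        rwa [show i + k + (l - k) = i + l by omega] at this
      · rfl
      · refine absurd hkl.symm ?_
        have := ih (k - l) (by omega) (by omega) (by omega) (i + l)
        rwa [show i + l + (k - l) = i + k by omega] at this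
    have hadj : G.Adj (v (i + (m + 2))) (v i) := by
      have := h (i + (m + 2))
      rwa [show i + (m + 2) + 1 = i + (m + 3) by omega, ← heq] at this
    -- By strong induction this is a shortest repetition, so the closed walk is a cycle, of length
    -- `m + 3 < g`.
    have hcyc : (Walk.cons hadj (walkOfSeq v h i (m + 2))).IsCycle := by
      rw [Walk.cons_isCycle_iff]
      constructor
      · rw [Walk.isPath_def, support_walkOfSeq]
        refine List.Nodup.map_on ?_ List.nodup_range
        intro k hk l hl hkl
        rw [List.mem_range] at hk hl
        exact hinj k l hk hl hkl
      · rw [edges_walkOfSeq, List.mem_map]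
        rintro ⟨k, hk, hke⟩
        rw [List.mem_range] at hk
        rcases Sym2.eq_iff.1 hke with ⟨h1, h2⟩ | ⟨h1, h2⟩
        · have := hinj k (m + 2) (by omega) (by omega) h1
          omega
        · have e1 := hinj k 0 (by omega) (by omega) h1
          have e2 := hinj (k + 1) (m + 2) (by omega) (by omega) h2
          omega
    have hle := le_egirth.1 hg _ _ hcyc
    rw [Walk.length_cons, length_walkOfSeq] at hle
    have : g ≤ m + 2 + 1 := by exact_mod_cast hle
    omega

/-- Discharging: if no two vertices of degree 2 are adjacent and every vertex of degree at least
3 has a neighbour of degree at least 3, then the average degree is at least `5 / 2`. -/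
lemma five_mul_card_le_four_mul_card_edges [Fintype V] [DecidableRel G.Adj]
    (hdeg : ∀ v, 2 ≤ G.degree v)
    (ha : ∀ u v, G.Adj u v → G.degree u = 2 → G.degree v ≠ 2)
    (hb : ∀ v, 3 ≤ G.degree v → ∃ w, G.Adj v w ∧ G.degree w ≠ 2) :
    5 * Fintype.card V ≤ 4 * G.edgeFinset.card := by
  classical
  -- The charge sent from `v` to `w`. Degree 2 ends with `8 + 2`; degree `d ≥ 3` keeps at least `4d
  -- - (d - 1) = 3d + 1`, because some neighbour receives nothing.
  let c : V → V → ℤ := fun v w =>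
    if G.Adj v w ∧ 3 ≤ G.degree v ∧ G.degree w = 2 then 1 else 0
  have hloc : ∀ v, (10 : ℤ) ≤ 4 * G.degree v - ∑ w, c v w + ∑ w, c w v := by
    intro v
    have hv := hdeg v
    rcases Nat.lt_or_ge (G.degree v) 3 with h3 | h3
    · have h2 : G.degree v = 2 := by omega
      have h1 : ∀ w, c v w = 0 := fun w => if_neg (by omega)
      have h4 : ∑ w, c w v = G.degree v := by
        rw [← G.card_neighborFinset_eq_degree v, neighborFinset_eq_filter,
          Finset.card_filter, Nat.cast_sum]
        refine Finset.sum_congr rfl fun w _ => ?_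
        simp only [c, G.adj_comm w v, h2, and_true, Nat.cast_ite, Nat.cast_one, Nat.cast_zero]
        refine if_congr ⟨fun h => h.1, fun h => ⟨h, ?_⟩⟩ rfl rfl
        have := ha v w h h2
        have := hdeg w
        omega
      simp only [h1, h4, h2]
      norm_num
    · obtain ⟨u, hu, hu2⟩ := hb v h3
      have h1 : ∀ w, c w v = 0 := fun w => if_neg (by omega)
      have h4 : ∑ w, c v w ≤ G.degree v - 1 := by
        have hle : ∑ w, c v w ≤ ((G.neighborFinset v).erase u).card := by
          rw [Finset.card_eq_sum_ones, Nat.cast_sum, ← Finset.sum_subset (Finset.subset_univ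
            ((G.neighborFinset v).erase u)) (f := c v)]
          · refine Finset.sum_le_sum fun w _ => ?_
            simp only [c]
            split_ifs <;> simp
          · intro w _ hw
            refine if_neg fun hh => hw ?_
            rw [Finset.mem_erase, mem_neighborFinset]
            refine ⟨?_, hh.1⟩
            rintro rfl
            exact hu2 hh.2.2
        rw [Finset.card_erase_of_mem (by simpa using hu), card_neighborFinset_eq_degree] at hle
        rw [Nat.cast_sub (by omega)] at hle
        exact_mod_cast hle
      simp only [h1, Finset.sum_const_zero]
      have : (3 : ℤ) ≤ G.degree v := by exact_mod_cast h3
      linarith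
  have hsum := Finset.sum_le_sum fun v (_ : v ∈ Finset.univ) => hloc v
  rw [Finset.sum_add_distrib, Finset.sum_sub_distrib, Finset.sum_comm (f := fun v w => c w v),
    ← Finset.mul_sum, ← Nat.cast_sum, G.sum_degrees_eq_twice_card_edges] at hsum
  simp only [Finset.sum_const, Finset.card_univ, nsmul_eq_mul] at hsum
  push_cast at hsum
  have : (10 : ℤ) * Fintype.card V ≤ 8 * G.edgeFinset.card := by linarith
  have : 10 * Fintype.card V ≤ 8 * G.edgeFinset.card := by exact_mod_cast this
  omega

end SimpleGraph

/-! ### Dimension count for circulations and coboundaries -/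

/-- If every vector in the kernel of a linear map to `ℂ^V` is the coboundary of a function that is
constant on the classes of an equivalence relation, then there are more than `|E| - |V|` classes. -/
lemma card_add_one_le_of_ker_le_coboundary {E V Q : Type*} [Fintype E] [Fintype V] [Fintype Q]
    [Nonempty Q] (B : (E → ℂ) →ₗ[ℂ] (V → ℂ)) (l r : E → Q) (a : ℂ) (ha : a ≠ 0)
    (h : ∀ Z, B Z = 0 → ∃ p : Q → ℂ, ∀ e, p (l e) - p (r e) = a * Z e) :
    Fintype.card E + 1 ≤ Fintype.card V + Fintype.card Q := by
  let δ : (Q → ℂ) →ₗ[ℂ] (E → ℂ) :=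
    { toFun := fun p e => p (l e) - p (r e)
      map_add' := fun p q => by ext e; simp; ring
      map_smul' := fun c p => by ext e; simp; ring }
  have h1 := B.finrank_range_add_finrank_ker
  have h2 := δ.finrank_range_add_finrank_ker
  have h3 : Module.finrank ℂ (LinearMap.range B) ≤ Fintype.card V := by
    have := Submodule.finrank_le (LinearMap.range B)
    rwa [Module.finrank_fintype_fun_eq_card] at this
  rw [Module.finrank_fintype_fun_eq_card] at h1 h2
  have h4 : LinearMap.ker B ≤ LinearMap.range δ := by
    intro Z hZ
    obtain ⟨p, hp⟩ := h Z hZ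
    refine ⟨a⁻¹ • p, ?_⟩
    ext e
    change a⁻¹ * p (l e) - a⁻¹ * p (r e) = Z e
    rw [← mul_sub, hp e, inv_mul_cancel_left₀ ha]
  have h5 := Submodule.finrank_mono h4
  -- Constants have zero coboundary; this supplies the `+ 1`.
  have h6 : 0 < Module.finrank ℂ (LinearMap.ker δ) := by
    have hmem : (fun _ => 1 : Q → ℂ) ∈ LinearMap.ker δ := by
      ext e
      simp [δ]
    refine Module.finrank_pos_iff_exists_ne_zero.2 ⟨⟨_, hmem⟩, fun h0 => ?_⟩
    have := congrFun (congrArg Subtype.val h0) (Classical.arbitrary Q)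
    simp at this
  omega

/-! ### Plane drawings as segment systems -/

/-- A drawing of `G` without crossings in the complex plane by polygonal arcs; the arc of an edge
`e` from `tail e` to `head e` has the corners `corner e 0, …, corner e (len e)`. -/
structure PolylineDrawing {V : Type*} (G : SimpleGraph V) where
  pos : V → ℂ
  tail : G.edgeSet → V
  head : G.edgeSet → V
  len : G.edgeSet → ℕ
  corner : G.edgeSet → ℕ → ℂ
  pos_injective : Function.Injective pos
  edge_eq : ∀ e, e.1 = s(tail e, head e)
  len_pos : ∀ e, 0 < len e
  corner_zero : ∀ e, corner e 0 = pos (tail e)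
  corner_len : ∀ e, corner e (len e) = pos (head e)
  corner_ne : ∀ e, ∀ i < len e, corner e i ≠ corner e (i + 1)
  inter_succ : ∀ e i, i + 1 < len e →
    segment ℝ (corner e i) (corner e (i + 1)) ∩ segment ℝ (corner e (i + 1)) (corner e (i + 2)) =
      {corner e (i + 1)}
  disjoint : ∀ e i j, i + 1 < j → j < len e →
    Disjoint (segment ℝ (corner e i) (corner e (i + 1)))
      (segment ℝ (corner e j) (corner e (j + 1)))
  crossing : ∀ e f, e ≠ f → ∀ i < len e, ∀ j < len f, ∀ z,
    z ∈ segment ℝ (corner e i) (corner e (i + 1)) →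
    z ∈ segment ℝ (corner f j) (corner f (j + 1)) → ∃ w ∈ e.1, w ∈ f.1 ∧ z = pos w

/-- A linear isometry from the plane to `ℂ` carries segments to segments. Choosing an order of the
two ends orients every edge, as flows require. -/
lemma PlaneDrawing.nonempty_polylineDrawing {V : Type*} {G : SimpleGraph V}
    (D : PlaneDrawing G) : Nonempty (PolylineDrawing G) := by
  let φ : Plane ≃ₗᵢ[ℝ] ℂ := Complex.orthonormalBasisOneI.repr.symm
  have hseg : ∀ a b, segment ℝ (φ a) (φ b) = φ '' segment ℝ a b := fun a b =>
    (image_segment ℝ φ.toLinearEquiv.toLinearMap.toAffineMap a b).symm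
  have hends : ∀ e : G.edgeSet, ∃ u v, e.1 = s(u, v) := fun e => by
    induction h : e.1 with
    | _ u v => exact ⟨u, v, rfl⟩
  choose tail head hth using hends
  have harc : ∀ e : G.edgeSet, IsPolygonalArc (D.pos (tail e)) (D.pos (head e)) (D.arc e.1) := by
    intro e
    have h := D.isPolygonalArc (tail e) (head e) (by
      rw [← SimpleGraph.mem_edgeSet, ← hth e]
      exact e.2)
    rwa [← hth e] at h
  choose n x hn h0 hlen hne hsucc hdis hA using harc
  refine ⟨⟨fun v => φ (D.pos v), tail, head, n, fun e k => φ (x e k),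
    φ.injective.comp D.pos_injective, hth, hn, fun e => by simp only [h0],
    fun e => by simp only [hlen], fun e i hi h => hne e i hi (φ.injective h), ?_, ?_, ?_⟩⟩
  · intro e i hi
    rw [hseg, hseg, ← Set.image_inter φ.injective, hsucc e i hi, Set.image_singleton]
  · intro e i j hij hj
    rw [hseg, hseg]
    exact (Set.disjoint_image_iff φ.injective).2 (hdis e i j hij hj)
  · intro e f hef i hi j hj z hze hzf
    rw [hseg] at hze hzf
    obtain ⟨y, hy, rfl⟩ := hze
    obtain ⟨y', hy', hyy⟩ := hzf
    obtain rfl := φ.injective hyy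
    have hye : y' ∈ D.arc e.1 := by
      rw [hA e]
      exact Set.mem_biUnion hi hy
    have hyf : y' ∈ D.arc f.1 := by
      rw [hA f]
      exact Set.mem_biUnion hj hy'
    obtain ⟨w, ⟨hwe, hwf⟩, hw⟩ := D.inter_subset e.1 e.2 f.1 f.2
      (fun h => hef (Subtype.ext h)) ⟨hye, hyf⟩
    exact ⟨w, hwe, hwf, by rw [hw]⟩

namespace PolylineDrawing

variable {V : Type*} {G : SimpleGraph V} (D : PolylineDrawing G)

/-- A corner lies only on the segments that it bounds. -/
lemma eq_or_eq_of_corner_mem {e : G.edgeSet} {k l : ℕ} (hk : k < D.len e) (hl : l ≤ D.len e)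
    (h : D.corner e l ∈ segment ℝ (D.corner e k) (D.corner e (k + 1))) : l = k ∨ l = k + 1 := by
  by_contra! hcon
  rcases Nat.lt_or_ge l k with hlk | hlk
  · have hmem := left_mem_segment ℝ (D.corner e l) (D.corner e (l + 1))
    rcases Nat.lt_or_ge (l + 1) k with h1 | h1
    · exact Set.disjoint_left.1 (D.disjoint e l k h1 hk) hmem h
    · obtain rfl : k = l + 1 := by omega
      have : D.corner e l ∈ ({D.corner e (l + 1)} : Set ℂ) := D.inter_succ e l hk ▸ ⟨hmem, h⟩
      exact D.corner_ne e l (by omega) this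
  · obtain ⟨m, rfl⟩ : ∃ m, l = m + 1 := ⟨l - 1, by omega⟩
    have hmem := right_mem_segment ℝ (D.corner e m) (D.corner e (m + 1))
    rcases Nat.lt_or_ge (k + 1) m with h1 | h1
    · exact Set.disjoint_left.1 (D.disjoint e k m h1 (by omega)) h hmem
    · obtain rfl : m = k + 1 := by omega
      have : D.corner e (k + 1 + 1) ∈ ({D.corner e (k + 1)} : Set ℂ) :=
        D.inter_succ e k (by omega) ▸ ⟨h, hmem⟩
      exact D.corner_ne e (k + 1) (by omega) this.symm

lemma corner_injOn (e : G.edgeSet) : Set.InjOn (D.corner e) (Set.Iic (D.len e)) := by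
  have key : ∀ k l, k < l → l ≤ D.len e → D.corner e k ≠ D.corner e l := by
    intro k l hkl hl h
    have hmem := left_mem_segment ℝ (D.corner e k) (D.corner e (k + 1))
    rcases D.eq_or_eq_of_corner_mem (hkl.trans_le hl) hl (h ▸ hmem) with rfl | rfl
    · omega
    · exact D.corner_ne e k (by omega) h
  intro k hk l hl h
  rcases lt_trichotomy k l with hlt | heq | hlt
  · exact absurd h (key k l hlt (Set.mem_Iic.1 hl))
  · exact heq
  · exact absurd h.symm (key l k hlt (Set.mem_Iic.1 hk))

/-- The segments of the drawing. -/
abbrev Seg : Type _ := (e : G.edgeSet) × Fin (D.len e)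

/-- The first endpoint of a segment. -/
def segStart (i : D.Seg) : ℂ := D.corner i.1 i.2

/-- The last endpoint of a segment. -/
def segEnd (i : D.Seg) : ℂ := D.corner i.1 (i.2 + 1)

/-- Within one arc this is simplicity of the arc. Segments of different edges meet only at a vertex
common to both edges, which is an extreme corner of each arc. -/
lemma isSegmentSystem : IsSegmentSystem D.segStart D.segEnd where
  ne i := D.corner_ne i.1 i.2 i.2.2
  inter_subset := by
    rintro ⟨e, k, hk⟩ ⟨f, l, hl⟩ hij z ⟨hz, hz'⟩
    simp only [segStart, segEnd] at *
    by_cases hef : e = f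
    · subst hef
      have hkl : k ≠ l := by
        rintro rfl
        exact hij rfl
      have key : ∀ a b, a < b → b < D.len e →
          z ∈ segment ℝ (D.corner e a) (D.corner e (a + 1)) →
          z ∈ segment ℝ (D.corner e b) (D.corner e (b + 1)) →
          b = a + 1 ∧ z = D.corner e (a + 1) := by
        intro a b hab hb ha hb'
        rcases Nat.lt_or_ge (a + 1) b with h1 | h1
        · exact absurd hb' (Set.disjoint_left.1 (D.disjoint e a b h1 hb) ha)
        · obtain rfl : b = a + 1 := by omega
          have : z ∈ ({D.corner e (a + 1)} : Set ℂ) := D.inter_succ e a hb ▸ ⟨ha, hb'⟩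
          exact ⟨rfl, this⟩
      rcases lt_or_gt_of_ne hkl with h | h
      · exact Or.inr (key k l h hl hz hz').2
      · obtain ⟨rfl, h2⟩ := key l k h hk hz' hz
        exact Or.inl h2
    · obtain ⟨w, hw, -, rfl⟩ := D.crossing e f hef k hk l hl z hz hz'
      rw [D.edge_eq e, Sym2.mem_iff] at hw
      rcases hw with rfl | rfl
      · rw [← D.corner_zero] at hz ⊢
        rcases D.eq_or_eq_of_corner_mem hk (Nat.zero_le _) hz with h | h
        · exact Or.inl (by rw [← h])
        · omega
      · rw [← D.corner_len] at hz ⊢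
        rcases D.eq_or_eq_of_corner_mem hk le_rfl hz with h | h
        · omega
        · exact Or.inr (by rw [← h]; rfl)

/-- An edge at whose arc a vertex is drawn contains the vertex, provided that the vertex lies on
some edge. -/
lemma mem_of_pos_mem {e f : G.edgeSet} {v : V} {k : ℕ} (hk : k < D.len e) (hv : v ∈ f.1)
    (h : D.pos v ∈ segment ℝ (D.corner e k) (D.corner e (k + 1))) : v ∈ e.1 := by
  by_cases hef : e = f
  · exact hef ▸ hv
  · obtain ⟨l, hl, hmem⟩ : ∃ l < D.len f,
        D.pos v ∈ segment ℝ (D.corner f l) (D.corner f (l + 1)) := by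
      have hpos := D.len_pos f
      rw [D.edge_eq f, Sym2.mem_iff] at hv
      rcases hv with rfl | rfl
      · exact ⟨0, hpos, by rw [← D.corner_zero]; exact left_mem_segment ℝ _ _⟩
      · refine ⟨D.len f - 1, by omega, ?_⟩
        rw [← D.corner_len, Nat.sub_add_cancel hpos]
        exact right_mem_segment ℝ _ _
    obtain ⟨w, hw, -, hvw⟩ := D.crossing e f hef k hk l hl _ h hmem
    rwa [D.pos_injective hvw]

section Flow

variable [Fintype V] [Fintype G.edgeSet] [DecidableEq V]

/-- The net inflow of edge weights at the vertices. -/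
def divergence : (G.edgeSet → ℂ) →ₗ[ℂ] (V → ℂ) where
  toFun Z v := ∑ e, Z e * ((if D.head e = v then 1 else 0) - if D.tail e = v then 1 else 0)
  map_add' Z Z' := by
    ext v
    simp [add_mul, Finset.sum_add_distrib]
  map_smul' c Z := by
    ext v
    simp [Finset.mul_sum, mul_assoc]

/-- Along each arc the differences telescope, so inner corners cancel and only the divergence at the
vertices remains. -/
lemma isFlow {Z : G.edgeSet → ℂ} (hZ : D.divergence Z = 0) :
    IsFlow D.segStart D.segEnd (fun i => Z i.1) := by
  intro g
  rw [Fintype.sum_sigma]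
  have h1 : ∀ e, ∑ k : Fin (D.len e), Z e * (g (D.segEnd ⟨e, k⟩) - g (D.segStart ⟨e, k⟩)) =
      ∑ v, Z e * ((if D.head e = v then 1 else 0) - if D.tail e = v then 1 else 0) *
        g (D.pos v) := by
    intro e
    rw [← Finset.mul_sum]
    have h2 := Fin.sum_univ_eq_sum_range
      (fun k => g (D.corner e (k + 1)) - g (D.corner e k)) (D.len e)
    rw [Finset.sum_range_sub (fun k => g (D.corner e k)), D.corner_zero, D.corner_len] at h2
    simp only [segStart, segEnd]
    rw [h2]
    simp [mul_assoc, ← Finset.mul_sum, sub_mul, Finset.sum_sub_distrib]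
  rw [Finset.sum_congr rfl fun e _ => h1 e, Finset.sum_comm]
  refine Finset.sum_eq_zero fun v _ => ?_
  rw [← Finset.sum_mul]
  have := congrFun hZ v
  change ∑ e, _ = _ at this
  rw [this, Pi.zero_apply, zero_mul]

/-- The winding sum of a flow on the edges. -/
noncomputable def winding (Z : G.edgeSet → ℂ) : ℂ → ℂ :=
  windingSum D.segStart D.segEnd (fun i : D.Seg => Z i.1)

/-- The one-sided limits of the winding sum are constant along each edge. -/
lemma exists_hasLeftLimit {Z : G.edgeSet → ℂ} (hZ : D.divergence Z = 0) (e : G.edgeSet) :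
    ∃ w, ∀ k < D.len e,
      HasLeftLimit (D.winding Z) (D.corner e k) (D.corner e (k + 1)) w ∧
      HasLeftLimit (D.winding Z) (D.corner e (k + 1)) (D.corner e k)
        (w - 2 * Real.pi * Complex.I * Z e) := by
  have hS := D.isSegmentSystem
  have hF := D.isFlow hZ
  have hk : ∀ k, ∃ w, k < D.len e →
      HasLeftLimit (D.winding Z) (D.corner e k) (D.corner e (k + 1)) w ∧
      HasLeftLimit (D.winding Z) (D.corner e (k + 1)) (D.corner e k)
        (w - 2 * Real.pi * Complex.I * Z e) := by
    intro k
    by_cases hk : k < D.len e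
    · obtain ⟨w, hw⟩ := hS.exists_hasLeftLimit hF ⟨e, k, hk⟩
      exact ⟨w, fun _ => hw⟩
    · exact ⟨0, fun h => absurd h hk⟩
  choose w hw using hk
  have hstep : ∀ k, k + 1 < D.len e → w k = w (k + 1) := by
    intro k hk1
    have hk0 : k < D.len e := by omega
    obtain ⟨⟨f, l, hl⟩, hne, c, hc, hnext⟩ := hS.exists_next (i := ⟨e, k, hk0⟩)
      (a := D.corner e (k + 1)) (b := D.corner e k) (Or.inr ⟨rfl, rfl⟩)
      ⟨⟨e, k + 1, hk1⟩, by simp, D.corner e (k + 2), Or.inl ⟨rfl, rfl⟩⟩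
    have hmem : D.corner e (k + 1) ∈ segment ℝ (D.corner f l) (D.corner f (l + 1)) := by
      have := hc.segment_eq
      simp only [segStart, segEnd] at this
      rw [this]
      exact left_mem_segment ℝ _ _
    -- Another edge could meet this arc only in a vertex, but an inner corner is neither end of the
    -- arc. So the next segment around the corner is the next one of the same arc.
    have hfe : f = e := by
      by_contra hfe
      obtain ⟨v, hv, hve, hpos⟩ := D.crossing f e hfe l hl k hk0 _ hmem
        (right_mem_segment ℝ _ _)
      rw [D.edge_eq e, Sym2.mem_iff] at hve
      rcases hve with rfl | rfl
      · rw [← D.corner_zero] at hpos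
        have := D.corner_injOn e (show k + 1 ≤ _ by omega) (Nat.zero_le _) hpos
        omega
      · rw [← D.corner_len] at hpos
        have := D.corner_injOn e (show k + 1 ≤ _ by omega) (show D.len e ≤ _ from le_rfl) hpos
        omega
    subst hfe
    have hlk : l = k + 1 := by
      rcases D.eq_or_eq_of_corner_mem hl (by omega) hmem with h | h
      · exact h.symm
      · obtain rfl : l = k := by omega
        exact absurd rfl hne
    subst hlk
    have hcc : c = D.corner f (k + 2) := by
      rcases hc with h | h
      · exact h.2.symm
      · exact absurd h.2.symm (D.corner_ne f (k + 1) hk1)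
    subst hcc
    exact hnext _ hF _ _ (hw k hk0).1 (hw (k + 1) hk1).1
  have hall : ∀ k, k < D.len e → w k = w 0 := by
    intro k
    induction k with
    | zero => exact fun _ => rfl
    | succ k ih => exact fun h => (hstep k h).symm.trans (ih (by omega))
  exact ⟨w 0, fun k hk => hall k hk ▸ hw k hk⟩

end Flow

/-- The source of an edge `e`, traversed forward for `(e, true)` and backward for
`(e, false)`. -/
def source (d : G.edgeSet × Bool) : V := if d.2 then D.tail d.1 else D.head d.1

/-- The target of a directed edge. -/
def target (d : G.edgeSet × Bool) : V := D.source (d.1, !d.2)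

/-- The first corner after the source on a directed edge. -/
def firstCorner (d : G.edgeSet × Bool) : ℂ :=
  if d.2 then D.corner d.1 1 else D.corner d.1 (D.len d.1 - 1)

/-- The first segment of a directed edge. -/
def firstSeg (d : G.edgeSet × Bool) : D.Seg :=
  if d.2 then ⟨d.1, 0, D.len_pos d.1⟩
  else ⟨d.1, D.len d.1 - 1, Nat.sub_lt (D.len_pos d.1) one_pos⟩

lemma hasEnds_firstSeg (d : G.edgeSet × Bool) :
    HasEnds D.segStart D.segEnd (D.firstSeg d) (D.pos (D.source d)) (D.firstCorner d) := by
  obtain ⟨e, b⟩ := d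
  cases b
  · refine Or.inr ⟨rfl, ?_⟩
    change D.corner e (D.len e - 1 + 1) = D.pos (D.head e)
    rw [Nat.sub_add_cancel (D.len_pos e), D.corner_len]
  · exact Or.inl ⟨D.corner_zero e, rfl⟩

lemma source_mem (d : G.edgeSet × Bool) : D.source d ∈ d.1.1 := by
  obtain ⟨e, b⟩ := d
  rw [D.edge_eq e]
  cases b <;> simp [source]

lemma exists_source_eq {e : G.edgeSet} {v : V} (hv : v ∈ e.1) : ∃ b, D.source (e, b) = v := by
  rw [D.edge_eq e, Sym2.mem_iff] at hv
  rcases hv with rfl | rfl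
  · exact ⟨true, rfl⟩
  · exact ⟨false, rfl⟩

lemma edge_eq_source_target (d : G.edgeSet × Bool) : d.1.1 = s(D.source d, D.target d) := by
  obtain ⟨e, b⟩ := d
  rw [D.edge_eq e]
  cases b
  · exact Sym2.eq_swap
  · rfl

lemma adj_source_target (d : G.edgeSet × Bool) : G.Adj (D.source d) (D.target d) := by
  rw [← SimpleGraph.mem_edgeSet, ← D.edge_eq_source_target]
  exact d.1.2

/-- A segment that ends at a vertex is the first segment of a directed edge from there. -/
lemma exists_firstSeg_eq {j : D.Seg} {v : V} {c : ℂ} {f : G.edgeSet} (hv : v ∈ f.1)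
    (hj : HasEnds D.segStart D.segEnd j (D.pos v) c) :
    ∃ d, D.firstSeg d = j ∧ D.source d = v ∧ D.firstCorner d = c := by
  obtain ⟨e, k, hk⟩ := j
  have hmem : D.pos v ∈ segment ℝ (D.corner e k) (D.corner e (k + 1)) := by
    have := hj.segment_eq
    simp only [segStart, segEnd] at this
    rw [this]
    exact left_mem_segment ℝ _ _
  obtain ⟨b, hb⟩ := D.exists_source_eq (D.mem_of_pos_mem hk hv hmem)
  have hfst : D.firstSeg (e, b) = ⟨e, k, hk⟩ := by
    have hlen := D.len_pos e
    cases b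
    · have hb' : D.pos v = D.corner e (D.len e) := by
        rw [D.corner_len, ← hb]
        rfl
      rw [hb'] at hmem
      obtain rfl : k = D.len e - 1 := by
        rcases D.eq_or_eq_of_corner_mem hk le_rfl hmem with h | h <;> omega
      rfl
    · have hb' : D.pos v = D.corner e 0 := by
        rw [D.corner_zero, ← hb]
        rfl
      rw [hb'] at hmem
      obtain rfl : k = 0 := by
        rcases D.eq_or_eq_of_corner_mem hk (Nat.zero_le _) hmem with h | h <;> omega
      rfl
  refine ⟨(e, b), hfst, hb, ?_⟩
  have h1 := D.hasEnds_firstSeg (e, b)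
  rw [hfst, hb] at h1
  have hne := D.corner_ne e k hk
  rcases h1 with h1 | h1 <;> rcases hj with h2 | h2
  · exact h1.2.symm.trans h2.2
  · exact absurd (h1.1.trans h2.2.symm) hne
  · exact absurd (h2.1.trans h1.2.symm) hne
  · exact h1.1.symm.trans h2.1

variable [Fintype V] [Fintype G.edgeSet] [DecidableEq V]

/-- Each directed edge has a successor that does not backtrack and lies on the boundary of the
same face. -/
lemma exists_next_dart (hdeg : ∀ v, ∀ e : G.edgeSet, v ∈ e.1 → ∃ f : G.edgeSet, f ≠ e ∧ v ∈ f.1)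
    (d : G.edgeSet × Bool) :
    ∃ d', D.source d' = D.target d ∧ D.target d' ≠ D.source d ∧
      ∀ Z, D.divergence Z = 0 → ∀ w w',
        HasLeftLimit (D.winding Z) (D.firstCorner (d.1, !d.2)) (D.pos (D.target d)) w →
        HasLeftLimit (D.winding Z) (D.pos (D.source d')) (D.firstCorner d') w' → w = w' := by
  have hfstSeg : ∀ d, (D.firstSeg d).1 = d.1 := by
    rintro ⟨e, _ | _⟩ <;> rfl
  have hmem : D.target d ∈ d.1.1 := D.source_mem (d.1, !d.2)
  obtain ⟨f, hfe, hf⟩ := hdeg _ _ hmem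
  obtain ⟨b, hb⟩ := D.exists_source_eq hf
  -- The first segment of the reversed edge is the last segment of `d`, which arrives at the target.
  obtain ⟨j, hne, c, hc, hnext⟩ := D.isSegmentSystem.exists_next
    (D.hasEnds_firstSeg (d.1, !d.2)) ⟨D.firstSeg (f, b), by
      intro h
      have := congrArg Sigma.fst h
      rw [hfstSeg, hfstSeg] at this
      exact hfe this, D.firstCorner (f, b), by
      have := D.hasEnds_firstSeg (f, b)
      rw [hb] at this
      exact this⟩
  obtain ⟨d', rfl, hsrc, rfl⟩ := D.exists_firstSeg_eq hmem hc
  refine ⟨d', hsrc, ?_, fun Z hZ w w' hw hw' => ?_⟩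
  · intro htgt
    apply hne
    -- A backtracking successor would be `d` reversed, whose first segment is the excluded one.
    have hedge : d'.1 = d.1 := by
      apply Subtype.ext
      rw [D.edge_eq_source_target d', D.edge_eq_source_target d, hsrc, htgt, Sym2.eq_swap]
    have hadj := (D.adj_source_target d).ne
    congr 1
    obtain ⟨e', b'⟩ := d'
    obtain ⟨e, b⟩ := d
    simp only at hedge
    subst hedge
    by_cases hbb : b' = b
    · subst hbb
      exact absurd hsrc hadj
    · cases b <;> cases b' <;> simp_all
  · rw [hsrc] at hw'
    exact hnext _ (D.isFlow hZ) w w' hw hw'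

end PolylineDrawing

/-! ### The Euler bound and the conclusion -/

/-- The Euler bound on the number of edges of a planar graph of girth at least `g` without vertices
of degree 1. -/
lemma PolylineDrawing.card_edges_le {V : Type*} [Fintype V] {G : SimpleGraph V}
    [Fintype G.edgeSet] [Nonempty G.edgeSet] (D : PolylineDrawing G)
    (hdeg : ∀ v, ∀ e : G.edgeSet, v ∈ e.1 → ∃ f : G.edgeSet, f ≠ e ∧ v ∈ f.1)
    {g : ℕ} (hg : (g : ℕ∞) ≤ G.egirth) :
    g * (Fintype.card G.edgeSet + 1) ≤ g * Fintype.card V + 2 * Fintype.card G.edgeSet := by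
  classical
  choose φ hsrc htgt hφ using D.exists_next_dart hdeg
  let R : G.edgeSet × Bool → G.edgeSet × Bool → Prop := fun d d' => d' = φ d
  -- The classes generated by the successor map play the role of faces; the map need not be shown to
  -- be a permutation.
  let Q := Quot R
  have : Finite Q := Quot.finite R
  have : Fintype Q := Fintype.ofFinite Q
  have hcard : Fintype.card Q * g ≤ 2 * Fintype.card G.edgeSet := by
    have hiter : ∀ (d : G.edgeSet × Bool) k, Quot.mk R (φ^[k] d) = Quot.mk R d := by
      intro d k
      induction k with
      | zero => rfl
      | succ k ih =>
        rw [Function.iterate_succ_apply', ← ih]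
        exact (Quot.sound (r := R) rfl).symm
    have hinj : ∀ d : G.edgeSet × Bool, ∀ k l, k < l → l < g → φ^[k] d ≠ φ^[l] d := by
      intro d k l hkl hl h
      have hne := SimpleGraph.ne_of_lt_egirth (v := fun k => D.source (φ^[k] d))
        (fun k => by
          have := D.adj_source_target (φ^[k] d)
          rwa [← hsrc, ← Function.iterate_succ_apply' φ] at this)
        (fun k => by
          have := htgt (φ^[k] d)
          rwa [← hsrc (φ _), ← Function.iterate_succ_apply' φ,
            ← Function.iterate_succ_apply' φ] at this)
        hg (l - k) (by omega) (by omega) k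
      apply hne
      rw [show k + (l - k) = l by omega, h]
    -- The first `g` iterates of a representative are distinct and stay in its class, and each edge
    -- has two directions.
    have hle := Fintype.card_le_of_injective
      (fun p : Q × Fin g => (φ^[p.2.1] p.1.out : G.edgeSet × Bool)) (by
        rintro ⟨q, k⟩ ⟨q', l⟩ h
        simp only at h
        have hq : q = q' := by
          rw [← q.out_eq, ← q'.out_eq, ← hiter q.out k, ← hiter q'.out l, h]
        subst hq
        rcases lt_trichotomy k.1 l.1 with h1 | h1 | h1
        · exact absurd h (hinj _ _ _ h1 l.2)
        · rw [Fin.ext h1]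
        · exact absurd h.symm (hinj _ _ _ h1 k.2))
    rw [Fintype.card_prod, Fintype.card_prod, Fintype.card_fin, Fintype.card_bool] at hle
    omega
  have hker : ∀ Z, D.divergence Z = 0 → ∃ p : Q → ℂ, ∀ e : G.edgeSet,
      p (Quot.mk R (e, true)) - p (Quot.mk R (e, false)) = 2 * Real.pi * Complex.I * Z e := by
    intro Z hZ
    choose w hw using D.exists_hasLeftLimit hZ
    -- `P d` is the limit on the left of `d`; the left of a reversed edge is the right of the edge,
    -- hence the jump.
    let P : G.edgeSet × Bool → ℂ := fun d =>
      if d.2 then w d.1 else w d.1 - 2 * Real.pi * Complex.I * Z d.1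
    have hfirst : ∀ d, HasLeftLimit (D.winding Z) (D.pos (D.source d)) (D.firstCorner d)
        (P d) := by
      rintro ⟨e, b⟩
      have hlen := D.len_pos e
      cases b
      · have := (hw e (D.len e - 1) (by omega)).2
        rwa [Nat.sub_add_cancel hlen, D.corner_len] at this
      · have := (hw e 0 hlen).1
        rwa [D.corner_zero] at this
    have hlast : ∀ d, HasLeftLimit (D.winding Z) (D.firstCorner (d.1, !d.2))
        (D.pos (D.target d)) (P d) := by
      rintro ⟨e, b⟩
      have hlen := D.len_pos e
      cases b
      · have := (hw e 0 hlen).2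
        rwa [D.corner_zero] at this
      · have := (hw e (D.len e - 1) (by omega)).1
        rwa [Nat.sub_add_cancel hlen, D.corner_len] at this
    refine ⟨Quot.lift P ?_, fun e => ?_⟩
    · rintro d _ rfl
      exact hφ d Z hZ _ _ (hlast d) (hfirst _)
    · change w e - (w e - 2 * Real.pi * Complex.I * Z e) = _
      ring
  have : Nonempty Q := ⟨Quot.mk R (Classical.arbitrary G.edgeSet, true)⟩
  have hmain := card_add_one_le_of_ker_le_coboundary D.divergence
    (fun e => (Quot.mk R (e, true) : Q)) (fun e => Quot.mk R (e, false))
    (2 * Real.pi * Complex.I) Complex.two_pi_I_ne_zero hker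
  calc g * (Fintype.card G.edgeSet + 1)
      ≤ g * (Fintype.card V + Fintype.card Q) := Nat.mul_le_mul_left _ hmain
    _ = g * Fintype.card V + Fintype.card Q * g := by ring
    _ ≤ _ := Nat.add_le_add_left hcard _

theorem mainTheorem7 {V : Type*} [Fintype V] (G : SimpleGraph V) [DecidableRel G.Adj]
    (hplanar : IsPlanar G) (hdeg : 2 ≤ G.minDegree) (hgirth : 10 ≤ G.egirth) :
    (∃ u v : V, G.Adj u v ∧ G.degree u = 2 ∧ G.degree v = 2) ∨
      (∃ v : V, 3 ≤ G.degree v ∧ ∀ w : V, G.Adj v w → G.degree w = 2) := by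
  classical
  by_contra! hcon
  obtain ⟨ha, hb⟩ := hcon
  have hd : ∀ v, 2 ≤ G.degree v := fun v => hdeg.trans (G.minDegree_le_degree v)
  have hlow := SimpleGraph.five_mul_card_le_four_mul_card_edges hd ha hb
  have hV : Nonempty V := by
    by_contra hV
    rw [not_nonempty_iff] at hV
    -- The minimum degree of the empty graph is 0 by convention.
    simp at hdeg
  obtain ⟨D⟩ := hplanar.some.nonempty_polylineDrawing
  have hE : Nonempty G.edgeSet := by
    obtain ⟨v⟩ := hV
    obtain ⟨w, hw⟩ := (G.degree_pos_iff_exists_adj v).1 (by have := hd v; omega)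
    exact ⟨⟨s(v, w), hw⟩⟩
  have hnext : ∀ v, ∀ e : G.edgeSet, v ∈ e.1 → ∃ f : G.edgeSet, f ≠ e ∧ v ∈ f.1 := by
    rintro v ⟨e, he⟩ hv
    obtain ⟨u, rfl⟩ := Sym2.mem_iff_exists.1 hv
    have h1 : 1 < (G.neighborFinset v).card := by
      rw [G.card_neighborFinset_eq_degree]
      exact hd v
    obtain ⟨w, hw, hwu⟩ := Finset.exists_mem_ne h1 u
    rw [SimpleGraph.mem_neighborFinset] at hw
    refine ⟨⟨s(v, w), hw⟩, ?_, Sym2.mem_mk_left v w⟩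
    intro h
    exact hwu (Sym2.congr_right.1 (congrArg Subtype.val h))
  have hup := D.card_edges_le hnext (g := 10) (by exact_mod_cast hgirth)
  rw [← SimpleGraph.edgeFinset_card] at hup
  -- For `g = 10` the upper bound reads `4|E| + 5 ≤ 5|V|`, against `5|V| ≤ 4|E|`.
  omega
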